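/- Let $a>1$ and $0<\nu<1$, and put $h(x)=1+ax(1-x)$ (the case $a=2$ is the Dynamic Alternative Routing model of Gibbens, Hunt and Kelly). For an integer $C\ge 1$ consider the system of ODEs, on $t\ge 0$, with arrival rate $\lambda=\nu C$, \[ \begin{cases} \dot x^C_0(t)=x^C_1(t)-\lambda h(x^C_C(t))\,x^C_0(t),\\ \dot x^C_j(t)=\lambda h(x^C_C(t))\,x^C_{j-1}(t)+(j+1)x^C_{j+1}(t)-\bigl(\lambda h(x^C_C(t))+j\bigr)x^C_j(t),\quad 1\le j<C,\\ \dot x^C_C(t)=\lambda h(x^C_C(t))\,x^C_{C-1}(t)-C\,x^C_C(t). \end{cases} \] There exists $\eta\in(0,1)$, depending only on $a$ and $\nu$, with the following property. For each $C\ge 1$ let $(x^C_k(t))_{0\le k\le C,\,t\ge 0}$ be a solution of this system whose initial value $(x^C_k(0))_{0\le k\le C}$ is a probability vector, and suppose that \[ \lim_{C\to\infty}\ \sum_{\eta C\le k\le C}x^C_k(0)=0 . \] Then there exists $\eta^*\in(0,1)$ such that $\sup_{t\ge 0}\sum_{\eta^*C\le k\le C}x^C_k(t)$ is finite for every $C\ge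 1$ and \[ \lim_{C\to\infty}\ \sup_{t\ge 0}\Bigl(\sum_{\eta^*C\le k\le C}x^C_k(t)\Bigr)=0 . \] -/

import Mathlib

open Filter Topology

/-- The function `h(x) = 1 + a x (1 - x)`; the value `a = 2` is the model of Gibbens, Hunt and
Kelly. -/
def darH (a x : ℝ) : ℝ := 1 + a * x * (1 - x)

/-- `p 0, …, p C` is a probability vector on `{0, …, C}` (other values of `p` play no role). -/
def IsProbVec (C : ℕ) (p : ℕ → ℝ) : Prop :=
  (∀ k ≤ C, 0 ≤ p k) ∧ ∑ k ∈ Finset.range (C + 1), p k = 1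

/-- `x t k`, for `t ≥ 0` and `0 ≤ k ≤ C`, solves the DAR system of ODEs with capacity `C ≥ 1` and
arrival rate `lam` on the time interval `[0, ∞)`. The derivative at `t = 0` is one-sided. -/
structure IsDARSolution (a lam : ℝ) (C : ℕ) (x : ℝ → ℕ → ℝ) : Prop where
  deriv_zero : ∀ t : ℝ, 0 ≤ t →
    HasDerivWithinAt (fun s => x s 0)
      (x t 1 - lam * darH a (x t C) * x t 0) (Set.Ici 0) t
  deriv_mid : ∀ t : ℝ, 0 ≤ t → ∀ j : ℕ, 1 ≤ j → j < C →
    HasDerivWithinAt (fun s => x s j)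
      (lam * darH a (x t C) * x t (j - 1) + ((j : ℝ) + 1) * x t (j + 1)
        - (lam * darH a (x t C) + (j : ℝ)) * x t j) (Set.Ici 0) t
  deriv_last : ∀ t : ℝ, 0 ≤ t →
    HasDerivWithinAt (fun s => x s C)
      (lam * darH a (x t C) * x t (C - 1) - (C : ℝ) * x t C) (Set.Ici 0) t

/-- The sum of `p k` over the states `k ∈ {0, …, C}` with `k ≥ η C`. -/
noncomputable def tailMass (η : ℝ) (C : ℕ) (p : ℕ → ℝ) : ℝ :=
  ∑ k ∈ (Finset.range (C + 1)).filter (fun k : ℕ => η * (C : ℝ) ≤ (k : ℝ)), p k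

/-! The proof is a Lyapunov barrier argument. Put η = (1+ν)/2 and let S(t) be the mean of the
squared positive part of k/C - η. By Chebyshev x_C ≤ S/(1-η)², so while S is small h(x_C) is near 1
and the arrival rate is at most μC with μ = ν + (1-ν)/4 < η. Above level η departures then outpace
arrivals, giving S' ≤ -2(η-μ)S + 2/C (`IsProbVec.sum_mul_darFlux_le`). Hence S cannot cross a small
level B exceeding 4/((1-ν)C) (`IsDARSolution.sqExcess_le`). The initial S is at most the initial
tail mass, so B can be taken to tend to 0, and Chebyshev at a level in (η, 1) turns smallness of S
into smallness of the tail. All this needs the solution to remain a probability vector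
(`IsDARSolution.isProbVec`), which is not immediate because h is negative far outside [0,1]. -/

/-- Probability flux from state `k` to state `k + 1`, for `k < C`. -/
def darFlux (a lam : ℝ) (C : ℕ) (p : ℕ → ℝ) (k : ℕ) : ℝ :=
  lam * darH a (p C) * p k - ((k : ℝ) + 1) * p (k + 1)

/-- The right-hand side of the DAR system at state `k`. -/
def darField (a lam : ℝ) (C : ℕ) (p : ℕ → ℝ) (k : ℕ) : ℝ :=
  (if k = 0 then 0 else darFlux a lam C p (k - 1)) - (if k = C then 0 else darFlux a lam C p k)

theorem IsDARSolution.hasDerivWithinAt {a lam : ℝ} {C : ℕ} {x : ℝ → ℕ → ℝ}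
    (hx : IsDARSolution a lam C x) (hC : 1 ≤ C) {t : ℝ} (ht : 0 ≤ t) {k : ℕ} (hk : k ≤ C) :
    HasDerivWithinAt (fun s => x s k) (darField a lam C (x t) k) (Set.Ici 0) t := by
  unfold darField darFlux
  rcases Nat.eq_zero_or_pos k with rfl | hk0
  · convert hx.deriv_zero t ht using 1
    rw [if_pos rfl, if_neg (by omega)]
    push_cast
    ring_nf
  · obtain ⟨j, rfl⟩ : ∃ j, k = j + 1 := ⟨k - 1, by omega⟩
    rcases hk.eq_or_lt with h | h
    · subst h
      convert hx.deriv_last t ht using 1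
      simp
    · convert hx.deriv_mid t ht (j + 1) (by omega) h using 1
      rw [if_neg (by omega), if_neg (by omega)]
      push_cast
      ring

/-! ### Flux form and conservation of mass -/

/-- Summation by parts; there is no flux into 0 from below or out of C upwards, so no boundary terms
appear. -/
theorem sum_mul_darField (a lam : ℝ) {C : ℕ} (p f : ℕ → ℝ) :
    ∑ k ∈ Finset.range (C + 1), f k * darField a lam C p k
      = ∑ k ∈ Finset.range C, (f (k + 1) - f k) * darFlux a lam C p k := by
  have h1 : ∑ k ∈ Finset.range (C + 1), f k * (if k = 0 then 0 else darFlux a lam C p (k - 1))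
      = ∑ k ∈ Finset.range C, f (k + 1) * darFlux a lam C p k := by
    rw [Finset.sum_range_succ']
    simp
  have h2 : ∑ k ∈ Finset.range (C + 1), f k * (if k = C then 0 else darFlux a lam C p k)
      = ∑ k ∈ Finset.range C, f k * darFlux a lam C p k := by
    rw [Finset.sum_range_succ]
    simp only [if_true, mul_zero, add_zero]
    refine Finset.sum_congr rfl fun k hk => ?_
    rw [if_neg (Finset.mem_range.1 hk).ne]
  simp only [darField, mul_sub, sub_mul, Finset.sum_sub_distrib, h1, h2]

theorem IsDARSolution.hasDerivWithinAt_sum {a lam : ℝ} {C : ℕ} {x : ℝ → ℕ → ℝ}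
    (hx : IsDARSolution a lam C x) (hC : 1 ≤ C) (f : ℕ → ℝ) {t : ℝ} (ht : 0 ≤ t) :
    HasDerivWithinAt (fun s => ∑ k ∈ Finset.range (C + 1), f k * x s k)
      (∑ k ∈ Finset.range C, (f (k + 1) - f k) * darFlux a lam C (x t) k) (Set.Ici 0) t := by
  rw [← sum_mul_darField]
  refine HasDerivWithinAt.fun_sum fun k hk => ?_
  exact (hx.hasDerivWithinAt hC ht (Finset.mem_range_succ_iff.1 hk)).const_mul (f k)

theorem IsDARSolution.sum_eq {a lam : ℝ} {C : ℕ} {x : ℝ → ℕ → ℝ}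
    (hx : IsDARSolution a lam C x) (hC : 1 ≤ C) {t : ℝ} (ht : 0 ≤ t) :
    ∑ k ∈ Finset.range (C + 1), x t k = ∑ k ∈ Finset.range (C + 1), x 0 k := by
  have hd : ∀ s : ℝ, 0 ≤ s →
      HasDerivWithinAt (fun s => ∑ k ∈ Finset.range (C + 1), x s k) 0 (Set.Ici 0) s := by
    intro s hs
    simpa using hx.hasDerivWithinAt_sum hC (fun _ => 1) hs
  refine constant_of_has_deriv_right_zero (a := 0) (b := t)
    (fun s hs => ((hd s hs.1).continuousWithinAt.mono Set.Icc_subset_Ici_self))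
    (fun s hs => (hd s hs.1).mono (Set.Ici_subset_Ici.2 hs.1)) t ⟨ht, le_rfl⟩

theorem darH_le {a : ℝ} (ha : 0 ≤ a) (x : ℝ) : darH a x ≤ 1 + a := by
  unfold darH
  nlinarith [mul_nonneg ha (sq_nonneg (x - 1 / 2))]

/-! ### Invariance of the set of probability vectors -/

theorem hasDerivAt_min_zero_sq (y : ℝ) :
    HasDerivAt (fun y : ℝ => min y 0 ^ 2) (2 * min y 0) y := by
  rcases lt_trichotomy y 0 with h | rfl | h
  · rw [min_eq_left h.le]
    have h1 : HasDerivAt (fun y : ℝ => y ^ 2) (2 * y) y := by simpa using hasDerivAt_pow 2 y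
    refine h1.congr_of_eventuallyEq ?_
    filter_upwards [gt_mem_nhds h] with z hz
    rw [min_eq_left hz.le]
  · rw [hasDerivAt_iff_isLittleO]
    simp only [min_self, ne_eq, OfNat.ofNat_ne_zero, not_false_eq_true, zero_pow, sub_zero,
      mul_zero, smul_eq_mul]
    have h1 : (fun y : ℝ => min y 0 ^ 2) =O[𝓝 0] fun y : ℝ => y ^ 2 := by
      refine Asymptotics.IsBigO.of_bound 1 (Eventually.of_forall fun y => ?_)
      rw [norm_pow, norm_pow, one_mul]
      gcongr
      rcases le_total y 0 with h | h
      · rw [min_eq_left h]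
      · rw [min_eq_right h, norm_zero]
        exact norm_nonneg _
    exact h1.trans_isLittleO (by simpa using Asymptotics.isLittleO_pow_id (𝕜 := ℝ) one_lt_two)
  · rw [min_eq_right h.le, mul_zero]
    refine (hasDerivAt_const y (0 : ℝ)).congr_of_eventuallyEq ?_
    filter_upwards [lt_mem_nhds h] with z hz
    rw [min_eq_right hz.le]
    simp

/-- After summation by parts the diagonal terms are nonpositive, and each cross term is at most a
product of negative parts because min(p, 0) is nonpositive and at most p. This is the Gronwall
estimate for the squared negative parts. -/
theorem sum_min_mul_darField_le {a lam : ℝ} (ha : 0 ≤ a) (hlam : 0 ≤ lam) {C : ℕ} (p : ℕ → ℝ)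
    (hp : 0 ≤ darH a (p C)) :
    ∑ k ∈ Finset.range (C + 1), min (p k) 0 * darField a lam C p k
      ≤ 2 * (lam * (1 + a) + C) * ∑ k ∈ Finset.range (C + 1), min (p k) 0 ^ 2 := by
  set m : ℕ → ℝ := fun k => min (p k) 0 with hm
  have hm0 : ∀ k, m k ≤ 0 := fun k => min_le_right _ _
  have hmp : ∀ k, m k ≤ p k := fun k => min_le_left _ _
  have hmm : ∀ k, m k * p k = m k ^ 2 := by
    intro k
    rcases le_total (p k) 0 with h | h
    · simp only [hm, min_eq_left h]; ring
    · simp only [hm, min_eq_right h]; ring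
  set K := lam * (1 + a) + C with hK
  set L := lam * darH a (p C) with hL
  have hL0 : 0 ≤ L := mul_nonneg hlam hp
  have hLK : L ≤ lam * (1 + a) := mul_le_mul_of_nonneg_left (darH_le ha _) hlam
  have hterm : ∀ k ∈ Finset.range C, (m (k + 1) - m k) * darFlux a lam C p k
      ≤ K * (m (k + 1) ^ 2 + m k ^ 2) := by
    intro k hk
    have hkC : (k : ℝ) + 1 ≤ C := by exact_mod_cast Finset.mem_range.1 hk
    have hk0 : (0 : ℝ) ≤ k := k.cast_nonneg
    have e : (m (k + 1) - m k) * darFlux a lam C p k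
        = L * (m (k + 1) * p k) - L * (m k * p k) - (k + 1) * (m (k + 1) * p (k + 1))
          + (k + 1) * (m k * p (k + 1)) := by
      rw [darFlux, ← hL]; ring
    rw [e, hmm, hmm]
    have i1 : m (k + 1) * p k ≤ m (k + 1) * m k :=
      mul_le_mul_of_nonpos_left (hmp k) (hm0 _)
    have i2 : m k * p (k + 1) ≤ m (k + 1) * m k := by
      rw [mul_comm (m (k + 1))]
      exact mul_le_mul_of_nonpos_left (hmp (k + 1)) (hm0 _)
    have i3 : m (k + 1) * m k ≤ m (k + 1) ^ 2 + m k ^ 2 := by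
      nlinarith [sq_nonneg (m (k + 1) - m k), sq_nonneg (m (k + 1)), sq_nonneg (m k)]
    have j1 := mul_le_mul_of_nonneg_left (i1.trans i3) hL0
    have j2 := mul_le_mul_of_nonneg_left (i2.trans i3) (by linarith : (0 : ℝ) ≤ k + 1)
    have j3 : (L + (k + 1)) * (m (k + 1) ^ 2 + m k ^ 2) ≤ K * (m (k + 1) ^ 2 + m k ^ 2) :=
      mul_le_mul_of_nonneg_right (by linarith) (by positivity)
    have j4 := mul_nonneg hL0 (sq_nonneg (m k))
    have j5 := mul_nonneg (by linarith : (0 : ℝ) ≤ k + 1) (sq_nonneg (m (k + 1)))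
    linarith
  have hK0 : 0 ≤ K := by positivity
  have s1 : ∑ k ∈ Finset.range C, m (k + 1) ^ 2 ≤ ∑ k ∈ Finset.range (C + 1), m k ^ 2 := by
    rw [Finset.sum_range_succ' (fun k => m k ^ 2)]
    exact le_add_of_nonneg_right (sq_nonneg _)
  have s2 : ∑ k ∈ Finset.range C, m k ^ 2 ≤ ∑ k ∈ Finset.range (C + 1), m k ^ 2 := by
    rw [Finset.sum_range_succ]
    exact le_add_of_nonneg_right (sq_nonneg _)
  rw [sum_mul_darField a lam p m]
  calc _ ≤ ∑ k ∈ Finset.range C, K * (m (k + 1) ^ 2 + m k ^ 2) := Finset.sum_le_sum hterm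
    _ = K * (∑ k ∈ Finset.range C, m (k + 1) ^ 2 + ∑ k ∈ Finset.range C, m k ^ 2) := by
      rw [← Finset.mul_sum, Finset.sum_add_distrib]
    _ ≤ K * (2 * ∑ k ∈ Finset.range (C + 1), m k ^ 2) := by
      apply mul_le_mul_of_nonneg_left _ hK0
      linarith
    _ = _ := by ring

/-- Nonnegativity propagates over a time interval on which the arrival rate is nonnegative. -/
theorem IsDARSolution.nonneg_of_darH_nonneg {a lam : ℝ} (ha : 0 ≤ a) (hlam : 0 ≤ lam) {C : ℕ}
    {x : ℝ → ℕ → ℝ} (hx : IsDARSolution a lam C x) (hC : 1 ≤ C) {s u : ℝ} (hs : 0 ≤ s)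
    (hH : ∀ t ∈ Set.Icc s u, 0 ≤ darH a (x t C)) (h0 : ∀ k ≤ C, 0 ≤ x s k) :
    ∀ t ∈ Set.Icc s u, ∀ k ≤ C, 0 ≤ x t k := by
  set φ : ℝ → ℝ := fun t => ∑ k ∈ Finset.range (C + 1), min (x t k) 0 ^ 2 with hφ
  set K : ℝ := 4 * (lam * (1 + a) + C) with hK
  have hd : ∀ t : ℝ, 0 ≤ t → HasDerivWithinAt φ
      (2 * ∑ k ∈ Finset.range (C + 1), min (x t k) 0 * darField a lam C (x t) k)
      (Set.Ici 0) t := by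
    intro t ht
    rw [Finset.mul_sum]
    refine HasDerivWithinAt.fun_sum fun k hk => ?_
    rw [← mul_assoc]
    exact (hasDerivAt_min_zero_sq (x t k)).comp_hasDerivWithinAt t
      (hx.hasDerivWithinAt hC ht (Finset.mem_range_succ_iff.1 hk))
  have hnn : ∀ t, 0 ≤ φ t := fun t => Finset.sum_nonneg fun k _ => sq_nonneg _
  have hφs : φ s = 0 := by
    refine Finset.sum_eq_zero fun k hk => ?_
    rw [min_eq_right (h0 k (Finset.mem_range_succ_iff.1 hk))]
    simp
  have hφ0 : ∀ t ∈ Set.Icc s u, φ t = 0 := by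
    intro t ht
    have hle := le_gronwallBound_of_liminf_deriv_right_le (f := φ)
      (f' := fun t => 2 * ∑ k ∈ Finset.range (C + 1), min (x t k) 0 * darField a lam C (x t) k)
      (δ := 0) (K := K) (ε := 0) (a := s) (b := u)
      (fun r hr => (hd r (hs.trans hr.1)).continuousWithinAt.mono
        (Set.Icc_subset_Ici_self.trans (Set.Ici_subset_Ici.2 hs)))
      (fun r hr q hq => by
        have h := (hd r (hs.trans hr.1)).mono (Set.Ici_subset_Ici.2 (hs.trans hr.1))
        simpa [slope_def_field, div_eq_inv_mul] using h.liminf_right_slope_le hq)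
      hφs.le
      (fun r hr => by
        have h := sum_min_mul_darField_le ha hlam (x r) (hH r ⟨hr.1, hr.2.le⟩)
        simp only [hφ, hK]
        linarith) t ht
    rw [gronwallBound_ε0_δ0] at hle
    exact le_antisymm hle (hnn t)
  intro t ht k hk
  have h := (Finset.sum_eq_zero_iff_of_nonneg (fun k _ => sq_nonneg _)).1 (hφ0 t ht) k
    (Finset.mem_range_succ_iff.2 hk)
  exact min_eq_right_iff.1 (pow_eq_zero_iff two_ne_zero |>.1 h)

theorem IsProbVec.le_one {C : ℕ} {p : ℕ → ℝ} (hp : IsProbVec C p) {k : ℕ} (hk : k ≤ C) :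
    p k ≤ 1 := by
  rw [← hp.2]
  exact Finset.single_le_sum (f := p) (fun j hj => hp.1 j (Finset.mem_range_succ_iff.1 hj))
    (Finset.mem_range_succ_iff.2 hk)

theorem one_le_darH {a y : ℝ} (ha : 0 ≤ a) (h0 : 0 ≤ y) (h1 : y ≤ 1) : 1 ≤ darH a y := by
  unfold darH
  have := mul_nonneg (mul_nonneg ha h0) (sub_nonneg.2 h1)
  linarith

theorem continuous_darH (a : ℝ) : Continuous (darH a) := by
  unfold darH
  fun_prop

/-- Continuous induction: at a time of nonnegativity, conserved mass puts x_C in [0,1], so h ≥ 1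
there and h > 0 shortly after, long enough for nonnegativity to propagate. -/
theorem IsDARSolution.isProbVec {a lam : ℝ} (ha : 0 ≤ a) (hlam : 0 ≤ lam) {C : ℕ}
    {x : ℝ → ℕ → ℝ} (hx : IsDARSolution a lam C x) (hC : 1 ≤ C) (h0 : IsProbVec C (x 0))
    {t : ℝ} (ht : 0 ≤ t) : IsProbVec C (x t) := by
  have hcont : ∀ k ≤ C, ContinuousOn (fun s => x s k) (Set.Ici 0) := fun k hk s hs =>
    (hx.hasDerivWithinAt hC hs hk).continuousWithinAt
  have hsub : Set.Icc 0 t ⊆ {s | ∀ k ≤ C, 0 ≤ x s k} := by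
    refine IsClosed.Icc_subset_of_forall_mem_nhdsWithin ?_ h0.1 ?_
    · have : {s | ∀ k ≤ C, 0 ≤ x s k} ∩ Set.Icc 0 t
          = Set.Icc 0 t ∩ ⋂ k ∈ Set.Iic C, Set.Icc 0 t ∩ (fun s => x s k) ⁻¹' Set.Ici 0 := by
        ext s
        simp only [Set.mem_inter_iff, Set.mem_ofPred_eq, Set.mem_iInter, Set.mem_Iic,
          Set.mem_preimage, Set.mem_Ici]
        exact ⟨fun h => ⟨h.2, fun k hk => ⟨h.2, h.1 k hk⟩⟩, fun h => ⟨fun k hk => (h.2 k hk).2, h.1⟩⟩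
      rw [this]
      refine isClosed_Icc.inter (isClosed_biInter fun k hk => ?_)
      exact ((hcont k hk).mono Set.Icc_subset_Ici_self).preimage_isClosed_of_isClosed
        isClosed_Icc isClosed_Ici
    · rintro s ⟨hs, hs0, -⟩
      have hp : IsProbVec C (x s) := ⟨hs, (hx.sum_eq hC hs0).trans h0.2⟩
      have hH : 0 < darH a (x s C) :=
        one_pos.trans_le (one_le_darH ha (hs C le_rfl) (hp.le_one le_rfl))
      have hc : ContinuousWithinAt (fun r => darH a (x r C)) (Set.Ici s) s :=
        (continuous_darH a).continuousAt.comp_continuousWithinAt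
          ((hcont C le_rfl s hs0).mono (Set.Ici_subset_Ici.2 hs0))
      obtain ⟨u, hu, hsu⟩ := (mem_nhdsGE_iff_exists_Icc_subset).1
        (hc.preimage_mem_nhdsWithin (Ioi_mem_nhds hH))
      filter_upwards [Icc_mem_nhdsGT hu] with r hr
      exact hx.nonneg_of_darH_nonneg ha hlam hC hs0 (fun q hq => le_of_lt (hsu hq)) hs r hr
  exact ⟨hsub ⟨ht, le_rfl⟩, (hx.sum_eq hC ht).trans h0.2⟩

/-! ### The Lyapunov function and its comparison with tail mass -/

/-- The excess of the occupancy `k / C` over the level `η`. -/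
noncomputable def excess (η : ℝ) (C k : ℕ) : ℝ := max ((k : ℝ) / C - η) 0

theorem excess_nonneg (η : ℝ) (C k : ℕ) : 0 ≤ excess η C k := le_max_right _ _

theorem excess_le_one {η : ℝ} (hη : 0 ≤ η) {C k : ℕ} (hk : k ≤ C) : excess η C k ≤ 1 := by
  have h : (k : ℝ) / C ≤ 1 := div_le_one_of_le₀ (by exact_mod_cast hk) C.cast_nonneg
  exact max_le (by linarith) zero_le_one

theorem level_mul_excess_le (η : ℝ) (C k : ℕ) :
    η * excess η C k ≤ (k : ℝ) / C * excess η C k := by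
  unfold excess
  rcases le_total ((k : ℝ) / C - η) 0 with h | h
  · rw [max_eq_right h]; simp
  · rw [max_eq_left h]; nlinarith

theorem excess_le_excess_succ (η : ℝ) (C k : ℕ) : excess η C k ≤ excess η C (k + 1) := by
  unfold excess
  gcongr
  simp

theorem excess_succ_le (η : ℝ) (C k : ℕ) :
    excess η C (k + 1) ≤ excess η C k + (C : ℝ)⁻¹ := by
  have h : ((k + 1 : ℕ) : ℝ) / C - η = ((k : ℝ) / C - η) + (C : ℝ)⁻¹ := by
    push_cast; ring
  have h0 : (0 : ℝ) ≤ (C : ℝ)⁻¹ := by positivity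
  unfold excess
  rw [h]
  exact max_le (by gcongr; exact le_max_left _ _) (add_nonneg (le_max_right _ _) h0)

/-- Arrivals out of k use this expansion at k; departures out of k+1 use the next one at k+1. The
error 1/C² against rates of order C costs only O(1/C). -/
theorem sq_excess_succ_sub_le (η : ℝ) (C k : ℕ) :
    excess η C (k + 1) ^ 2 - excess η C k ^ 2
      ≤ 2 * excess η C k * (C : ℝ)⁻¹ + (C : ℝ)⁻¹ ^ 2 := by
  have h := pow_le_pow_left₀ (excess_nonneg η C (k + 1)) (excess_succ_le η C k) 2
  nlinarith

theorem le_sq_excess_succ_sub (η : ℝ) (C k : ℕ) :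
    2 * excess η C (k + 1) * (C : ℝ)⁻¹ - (C : ℝ)⁻¹ ^ 2
      ≤ excess η C (k + 1) ^ 2 - excess η C k ^ 2 := by
  unfold excess
  have h : ((k + 1 : ℕ) : ℝ) / C - η = ((k : ℝ) / C - η) + (C : ℝ)⁻¹ := by
    push_cast; ring
  have h0 : (0 : ℝ) ≤ (C : ℝ)⁻¹ := by positivity
  rw [h]
  generalize (k : ℝ) / C - η = y
  generalize (C : ℝ)⁻¹ = c at *
  rcases le_total y 0 with hy | hy
  · rw [max_eq_right hy]
    nlinarith [sq_nonneg (max (y + c) 0 - c)]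
  · rw [max_eq_left hy, max_eq_left (by linarith)]
    nlinarith

/-- The mean square excess of `p` over the level `η`. -/
noncomputable def sqExcess (η : ℝ) (C : ℕ) (p : ℕ → ℝ) : ℝ :=
  ∑ k ∈ Finset.range (C + 1), excess η C k ^ 2 * p k

theorem IsProbVec.sqExcess_le_tailMass {η : ℝ} (hη : 0 ≤ η) {C : ℕ} (hC : 1 ≤ C) {p : ℕ → ℝ}
    (hp : IsProbVec C p) : sqExcess η C p ≤ tailMass η C p := by
  have hC0 : (0 : ℝ) < C := by exact_mod_cast hC
  unfold sqExcess tailMass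
  rw [Finset.sum_filter]
  refine Finset.sum_le_sum fun k hk => ?_
  rw [Finset.mem_range_succ_iff] at hk
  split_ifs with h
  · exact mul_le_of_le_one_left (hp.1 k hk)
      (pow_le_one₀ (excess_nonneg _ _ _) (excess_le_one hη hk))
  · have : excess η C k = 0 := by
      refine max_eq_right (sub_nonpos.2 ?_)
      rw [div_le_iff₀ hC0]
      exact (not_le.1 h).le
    simp [this]

theorem IsProbVec.mul_tailMass_le_sqExcess {η ζ : ℝ} (hζ : η ≤ ζ) {C : ℕ} (hC : 1 ≤ C)
    {p : ℕ → ℝ} (hp : IsProbVec C p) : (ζ - η) ^ 2 * tailMass ζ C p ≤ sqExcess η C p := by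
  have hC0 : (0 : ℝ) < C := by exact_mod_cast hC
  unfold sqExcess tailMass
  rw [Finset.sum_filter, Finset.mul_sum]
  refine Finset.sum_le_sum fun k hk => ?_
  rw [Finset.mem_range_succ_iff] at hk
  split_ifs with h
  · refine mul_le_mul_of_nonneg_right (pow_le_pow_left₀ (sub_nonneg.2 hζ) ?_ 2) (hp.1 k hk)
    refine le_trans ?_ (le_max_left _ _)
    gcongr
    rwa [le_div_iff₀ hC0]
  · rw [mul_zero]
    exact mul_nonneg (sq_nonneg _) (hp.1 k hk)

theorem IsProbVec.mul_last_le_sqExcess {η : ℝ} {C : ℕ} (hC : 1 ≤ C) {p : ℕ → ℝ}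
    (hp : IsProbVec C p) (hη : η ≤ 1) : (1 - η) ^ 2 * p C ≤ sqExcess η C p := by
  refine le_trans (mul_le_mul_of_nonneg_left ?_ (sq_nonneg _)) (hp.mul_tailMass_le_sqExcess hη hC)
  refine Finset.single_le_sum (f := p) (fun k hk => hp.1 k ?_) ?_
  · exact Finset.mem_range_succ_iff.1 (Finset.mem_filter.1 hk).1
  · simp

theorem IsProbVec.tailMass_nonneg {η : ℝ} {C : ℕ} {p : ℕ → ℝ} (hp : IsProbVec C p) :
    0 ≤ tailMass η C p :=
  Finset.sum_nonneg fun k hk => hp.1 k (Finset.mem_range_succ_iff.1 (Finset.mem_filter.1 hk).1)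

theorem IsProbVec.tailMass_le_one {η : ℝ} {C : ℕ} {p : ℕ → ℝ} (hp : IsProbVec C p) :
    tailMass η C p ≤ 1 := by
  rw [← hp.2]
  exact Finset.sum_le_sum_of_subset_of_nonneg (Finset.filter_subset _ _)
    fun k hk _ => hp.1 k (Finset.mem_range_succ_iff.1 hk)

/-! ### Drift inequality and barrier -/

/-- Drift of the mean square excess at arrival rate at most `μ C`, for `μ ≤ η`. -/
theorem IsProbVec.sum_mul_darFlux_le {a lam μ η : ℝ} {C : ℕ} (hC : 1 ≤ C) {p : ℕ → ℝ}
    (hp : IsProbVec C p) (hr0 : 0 ≤ lam * darH a (p C)) (hr : lam * darH a (p C) ≤ μ * C)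
    (hη0 : 0 ≤ η) (hμη : μ ≤ η) (hη : η ≤ 1) :
    ∑ k ∈ Finset.range C, (excess η C (k + 1) ^ 2 - excess η C k ^ 2) * darFlux a lam C p k
      ≤ -(2 * (η - μ)) * sqExcess η C p + 2 / C := by
  have hC0 : (0 : ℝ) < C := by exact_mod_cast hC
  set c : ℝ := (C : ℝ)⁻¹ with hc
  have hc0 : 0 < c := inv_pos.2 hC0
  have hCc : (C : ℝ) * c = 1 := mul_inv_cancel₀ hC0.ne'
  have hμ0 : 0 ≤ μ := by
    by_contra! h
    nlinarith [hr0.trans hr]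
  -- `A k` bounds the gain from arrivals in state k from above, `D k` the loss from departures in
  -- state k from below.
  set A : ℕ → ℝ := fun k => (2 * μ * excess η C k + c) * p k with hA
  set D : ℕ → ℝ := fun k => (2 * (k / C) * excess η C k - c) * p k with hD
  have hA0 : ∀ k ≤ C, 0 ≤ A k := fun k hk =>
    mul_nonneg (by have := mul_nonneg hμ0 (excess_nonneg η C k); linarith) (hp.1 k hk)
  have hterm : ∀ k ∈ Finset.range C,
      (excess η C (k + 1) ^ 2 - excess η C k ^ 2) * darFlux a lam C p k ≤ A k - D (k + 1) := by
    intro k hk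
    have hkC := Finset.mem_range.1 hk
    have hpk := hp.1 k hkC.le
    have hpk1 := hp.1 (k + 1) hkC
    have hk1 : ((k + 1 : ℕ) : ℝ) ≤ C := by exact_mod_cast hkC
    have h1 := sq_excess_succ_sub_le η C k
    have h2 := le_sq_excess_succ_sub η C k
    have h3 : 0 ≤ excess η C (k + 1) ^ 2 - excess η C k ^ 2 :=
      sub_nonneg.2 (pow_le_pow_left₀ (excess_nonneg _ _ _) (excess_le_excess_succ η C k) 2)
    have hu := excess_nonneg η C k
    rw [← hc] at h1 h2
    set d := excess η C (k + 1) ^ 2 - excess η C k ^ 2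
    have up : d * (lam * darH a (p C)) ≤ 2 * μ * excess η C k + c := by
      calc d * (lam * darH a (p C)) ≤ (2 * excess η C k * c + c ^ 2) * (μ * C) :=
            mul_le_mul h1 hr hr0 (h3.trans h1)
        _ = 2 * μ * excess η C k * (C * c) + μ * c * (C * c) := by ring
        _ ≤ _ := by
            rw [hCc]
            nlinarith
    have down : 2 * ((k + 1 : ℕ) / C) * excess η C (k + 1) - c ≤ d * ((k + 1 : ℕ) : ℝ) := by
      calc _ = 2 * ((k + 1 : ℕ) : ℝ) * c * excess η C (k + 1) - c * (C * c) := by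
            rw [hCc, hc]; ring
        _ ≤ (2 * excess η C (k + 1) * c - c ^ 2) * ((k + 1 : ℕ) : ℝ) := by
            nlinarith [mul_le_mul_of_nonneg_left hk1 (sq_nonneg c)]
        _ ≤ _ := mul_le_mul_of_nonneg_right h2 (Nat.cast_nonneg _)
    have e1 := mul_le_mul_of_nonneg_right up hpk
    have e2 := mul_le_mul_of_nonneg_right down hpk1
    simp only [hA, hD, darFlux]
    push_cast at e2 ⊢
    linarith
  have hsA : ∑ k ∈ Finset.range C, A k ≤ ∑ k ∈ Finset.range (C + 1), A k := by
    rw [Finset.sum_range_succ]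
    exact le_add_of_nonneg_right (hA0 C le_rfl)
  have hsD : -∑ k ∈ Finset.range C, D (k + 1) ≤ -∑ k ∈ Finset.range (C + 1), D k := by
    rw [Finset.sum_range_succ' D, neg_le_neg_iff]
    refine add_le_of_nonpos_right ?_
    have := mul_nonneg hc0.le (hp.1 0 (Nat.zero_le C))
    simp only [hD, Nat.cast_zero, zero_div, mul_zero, zero_mul, zero_sub]
    linarith
  calc _ ≤ ∑ k ∈ Finset.range C, (A k - D (k + 1)) := Finset.sum_le_sum hterm
    _ ≤ ∑ k ∈ Finset.range (C + 1), (A k - D k) := by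
      rw [Finset.sum_sub_distrib, Finset.sum_sub_distrib]
      linarith
    -- For u the excess, (k/C)u ≥ ηu and u² ≤ u, since 0 ≤ u ≤ 1.
    _ ≤ ∑ k ∈ Finset.range (C + 1), (-(2 * (η - μ)) * (excess η C k ^ 2 * p k) + 2 * c * p k) := by
      refine Finset.sum_le_sum fun k hk => ?_
      have hkC := Finset.mem_range_succ_iff.1 hk
      have hu0 := excess_nonneg η C k
      have hu1 := excess_le_one hη0 hkC
      have h1 := level_mul_excess_le η C k
      have h2 : excess η C k ^ 2 ≤ excess η C k := by nlinarith
      have h3 := mul_le_mul_of_nonneg_left h2 (sub_nonneg.2 hμη)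
      have h4 : (2 * μ * excess η C k + c) - (2 * (k / C) * excess η C k - c)
          ≤ -(2 * (η - μ)) * excess η C k ^ 2 + 2 * c := by linarith
      have h5 := mul_le_mul_of_nonneg_right h4 (hp.1 k hkC)
      simp only [hA, hD]
      linarith
    _ = _ := by
      rw [Finset.sum_add_distrib, ← Finset.mul_sum, ← Finset.mul_sum, hp.2, sqExcess, hc]
      ring

/-- A small initial mean square excess stays small. -/
theorem IsDARSolution.sqExcess_le {a ν : ℝ} (ha : 0 < a) (hν0 : 0 < ν) (hν1 : ν < 1) {C : ℕ}
    (hC : 1 ≤ C) {x : ℝ → ℕ → ℝ} (hx : IsDARSolution a (ν * C) C x) (h0 : IsProbVec C (x 0))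
    {B : ℝ} (hB0 : sqExcess ((1 + ν) / 2) C (x 0) ≤ B) (hBC : 4 / (1 - ν) / C < B)
    (hB : a * B ≤ ((1 - ν) / 2) ^ 2 * ((1 - ν) / 4)) {t : ℝ} (ht : 0 ≤ t) :
    sqExcess ((1 + ν) / 2) C (x t) ≤ B := by
  have hC0 : (0 : ℝ) < C := by exact_mod_cast hC
  set η := (1 + ν) / 2 with hη
  have hd := fun s (hs : 0 ≤ s) => hx.hasDerivWithinAt_sum hC (fun k => excess η C k ^ 2) hs
  -- It suffices that the derivative is negative whenever the value equals B.
  refine image_le_of_deriv_right_lt_deriv_boundary (f := fun s => sqExcess η C (x s)) (a := 0)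
    (b := t) (B := fun _ => B) (B' := fun _ => 0)
    (fun s hs => (hd s hs.1).continuousWithinAt.mono Set.Icc_subset_Ici_self)
    (fun s hs => (hd s hs.1).mono (Set.Ici_subset_Ici.2 hs.1)) hB0
    (fun s => hasDerivAt_const s B) ?_ ⟨ht, le_rfl⟩
  intro s hs hsB
  have hp := hx.isProbVec ha.le (by positivity) hC h0 hs.1
  have hxC0 := hp.1 C le_rfl
  have hlast := hp.mul_last_le_sqExcess (η := η) hC (by linarith)
  rw [hsB] at hlast
  have hsmall : a * x s C ≤ (1 - ν) / 4 := by
    have hpos : 0 < ((1 - ν) / 2) ^ 2 := by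
      have : 0 < 1 - ν := by linarith
      positivity
    refine le_of_mul_le_mul_left (le_trans ?_ hB) hpos
    have e : 1 - η = (1 - ν) / 2 := by rw [hη]; ring
    rw [e] at hlast
    calc _ = a * (((1 - ν) / 2) ^ 2 * x s C) := by ring
      _ ≤ _ := mul_le_mul_of_nonneg_left hlast ha.le
  have hH0 := one_le_darH ha.le hxC0 (hp.le_one le_rfl)
  have hH1 : darH a (x s C) ≤ 1 + (1 - ν) / 4 := by
    unfold darH
    nlinarith [mul_nonneg (mul_nonneg ha.le hxC0) hxC0]
  have hdrift := hp.sum_mul_darFlux_le (a := a) (lam := ν * C) (μ := ν + (1 - ν) / 4) (η := η) hC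
    (by positivity)
    (by
      have h := mul_le_mul_of_nonneg_left hH1 (by positivity : 0 ≤ ν * (C : ℝ))
      refine h.trans ?_
      have : ν * (1 + (1 - ν) / 4) ≤ ν + (1 - ν) / 4 := by nlinarith
      nlinarith)
    (by linarith) (by linarith) (by linarith)
  refine hdrift.trans_lt ?_
  rw [hsB]
  have e : 2 * (η - (ν + (1 - ν) / 4)) = (1 - ν) / 2 := by rw [hη]; ring
  rw [e]
  have h1 : (1 - ν) / 2 * (4 / (1 - ν) / C) < (1 - ν) / 2 * B :=
    mul_lt_mul_of_pos_left hBC (by linarith)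
  have h2 : (1 - ν) / 2 * (4 / (1 - ν) / C) = 2 / C := by
    have : 1 - ν ≠ 0 := by linarith
    field_simp
    norm_num
  linarith

theorem mainTheorem6 (a : ℝ) (ha : 1 < a) (ν : ℝ) (hν0 : 0 < ν) (hν1 : ν < 1) :
    ∃ η : ℝ, 0 < η ∧ η < 1 ∧
      ∀ x : ℕ → ℝ → ℕ → ℝ,
        (∀ C : ℕ, 1 ≤ C → IsProbVec C (x C 0)) →
        (∀ C : ℕ, 1 ≤ C → IsDARSolution a (ν * (C : ℝ)) C (x C)) →
        Tendsto (fun C : ℕ => tailMass η C (x C 0)) atTop (𝓝 0) →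
        ∃ ηs : ℝ, 0 < ηs ∧ ηs < 1 ∧
          (∀ C : ℕ, 1 ≤ C →
            BddAbove (Set.range (fun t : Set.Ici (0 : ℝ) => tailMass ηs C (x C (t : ℝ))))) ∧
          Tendsto (fun C : ℕ => ⨆ t : Set.Ici (0 : ℝ), tailMass ηs C (x C (t : ℝ)))
            atTop (𝓝 0) := by
  refine ⟨(1 + ν) / 2, by linarith, by linarith, fun x h0 hx hlim => ?_⟩
  have hprob : ∀ C : ℕ, 1 ≤ C → ∀ t : ℝ, 0 ≤ t → IsProbVec C (x C t) := fun C hC t ht =>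
    (hx C hC).isProbVec (by linarith) (by positivity) hC (h0 C hC) ht
  -- The midpoint of η and 1.
  set ζ := (3 + ν) / 4 with hζ
  have hgap : 0 < (ζ - (1 + ν) / 2) ^ 2 := by
    have : 0 < ζ - (1 + ν) / 2 := by rw [hζ]; linarith
    positivity
  refine ⟨ζ, by linarith, by linarith, fun C hC => ⟨1, ?_⟩, ?_⟩
  · rintro _ ⟨t, rfl⟩
    exact (hprob C hC t t.2).tailMass_le_one
  -- The 5 in place of 4 makes the barrier strict even if the initial tail mass vanishes.
  set B : ℕ → ℝ := fun C => tailMass ((1 + ν) / 2) C (x C 0) + 5 / (1 - ν) / C with hBdef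
  have hBlim : Tendsto B atTop (𝓝 0) := by
    simpa using hlim.add (tendsto_const_div_atTop_nhds_zero_nat (5 / (1 - ν)))
  have hsmall : ∀ᶠ C in atTop, a * B C ≤ ((1 - ν) / 2) ^ 2 * ((1 - ν) / 4) := by
    have h := hBlim.const_mul a
    rw [mul_zero] at h
    have : 0 < 1 - ν := by linarith
    exact (h.eventually_lt_const (by positivity)).mono fun _ h => h.le
  have hupper : Tendsto (fun C => B C / (ζ - (1 + ν) / 2) ^ 2) atTop (𝓝 0) := by
    simpa using hBlim.div_const ((ζ - (1 + ν) / 2) ^ 2)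
  refine tendsto_of_tendsto_of_tendsto_of_le_of_le' tendsto_const_nhds hupper ?_ ?_
  · filter_upwards [eventually_ge_atTop 1] with C hC
    exact Real.iSup_nonneg fun t => (hprob C hC t t.2).tailMass_nonneg
  · filter_upwards [eventually_ge_atTop 1, hsmall] with C hC hsm
    have hC0 : (0 : ℝ) < C := by exact_mod_cast hC
    have hν : 0 < 1 - ν := by linarith
    have htail := (h0 C hC).tailMass_nonneg (η := (1 + ν) / 2)
    refine ciSup_le fun t => ?_
    rw [le_div_iff₀ hgap, mul_comm]
    refine ((hprob C hC t t.2).mul_tailMass_le_sqExcess (by rw [hζ]; linarith) hC).trans ?_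
    refine (hx C hC).sqExcess_le (by linarith) hν0 hν1 hC (h0 C hC) ?_ ?_ hsm t.2
    · refine ((h0 C hC).sqExcess_le_tailMass (by linarith) hC).trans ?_
      exact le_add_of_nonneg_right (by positivity)
    · have : 4 / (1 - ν) / C < 5 / (1 - ν) / C := by gcongr; norm_num
      simp only [hBdef]
      linarith
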